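/- **Setting.** Fix a class of $d$-dimensional source manifolds (manifolds carrying sources, considered up to equivalence). For every finite family $\mathcal B=(b_i)_i$ of closed boundary manifolds let $Y_{\mathcal B}$ be the set of rimmed source manifolds ("surfaces") whose boundary is the labelled disjoint union of the $b_i$; for the empty family this is the set $X$ of closed source manifolds. Surfaces can be relabelled, disjointly united, sewn together along pairs of equal boundary pieces, and reflected by an involution $*$ (complex conjugation of the sources and reflection); these operations satisfy the usual identities of manifolds. For each boundary manifold $B$ and $\beta>0$ there is a cylinder $C_\beta=B\times[0,\beta]\in Y_{B\sqcup B}$, which is invariant under $*$ and under the exchange of its ends, with $C_\alpha C_\beta=C_{\alpha+\beta}$ (juxtaposition is gluing the right boundary of the first surface to the left boundary of the second). Rimmed means that near any boundary piece $B$ a surface coincides with a cylinder: if $B$ is the left boundary of $s$, then $s=C_\epsilon s^\epsilon$ for some $\epsilon>0$ and some surface $s^\epsilon$ with the same boundary. Let $\zeta:X\to\mathbb C$ be a path integral, that is, a map such that: (reality) $\zeta(M^*)=\overline{\zeta(M)}$; (reflection positivity) $\sum_{I,J=1}^n\overline{\gamma_I}\gamma_J\,\zeta(M_{N_I^*N_J})$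 is real and $\ge 0$ for all $\gamma_I\in\mathbb C$ and surfaces $N_I$ with a common boundary $\mathcal B$, where $M_{N^*N'}$ is $N^*$ sewn to $N'$ along all of $\mathcal B$; (continuity) if a closed manifold contains a cylinder $C_\epsilon$, $\zeta$ is continuous in its length $\epsilon>0$; (factorization) $\zeta(M\sqcup M')=\zeta(M)\zeta(M')$. Let $H_{\mathcal B}$ be the space of finite formal complex combinations of surfaces in $Y_{\mathcal B}$ with the pre-inner product determined by $\langle N|N'\rangle=\zeta(M_{N^*N'})$, and $\mathcal H_{\mathcal B}$ the Hilbert space obtained by dividing out null vectors and completing; write $|f\rangle\in\mathcal H_{\mathcal B}$ for the vector of $f\in H_{\mathcal B}$. For boundary manifolds $B_L,B_R$ put $LL=B_L\sqcup B_L$ and $LR=B_L\sqcup B_R$. Gluing extends bilinearly to formal combinations. * For $a\in H_{LL}$, $\hat a_L$ is the bounded operator on $\mathcal H_{LL}$ with $\hat a_L|f\rangle=|af\rangle$. $\mathcal A_L^{LL}$ is the closure of $\{\hat a_L: a\in H_{LL}\}$ in the weak operator topology on $\mathcal B(\mathcal H_{LL})$. * $\gamma\mapsto\hat\gamma_R$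 is the unique continuous linear map $\mathcal H_{LR}\to\mathcal B(\mathcal H_{LL},\mathcal H_{LR})$ with $\hat\gamma_R|f\rangle=|fg\rangle$ for $|\gamma\rangle=|g\rangle$, $g\in H_{LR}$, $f\in H_{LL}$; $|\hat\gamma_R|$ is the positive square root of $\hat\gamma_R^\dagger\hat\gamma_R$. * For $a\in\mathcal A_L^{LL}$, $\Phi_{LR}(a)$ is the bounded operator on $\mathcal H_{LR}$ with $\Phi_{LR}(a)|C_\epsilon\varphi\rangle=\hat\varphi_R\,a|C_\epsilon\rangle$ for all $\epsilon>0$ and $\varphi\in H_{LR}$, where $\hat\varphi_R$ is the operator of $|\varphi\rangle$ and $C_\epsilon$ is the cylinder over $B_L$. **Claim.** For every $a\in\mathcal A_L^{LL}$ the operator $\Phi_{LR}(a)$ exists and is unique. For every $|\gamma\rangle\in\mathcal H_{LR}$ the limit $$|\gamma_{LL}\rangle:=\lim_{\beta\downarrow0}|\hat\gamma_R|\,|C_\beta\rangle$$ exists in norm in $\mathcal H_{LL}$, and for all $a\in\mathcal A_L^{LL}$ $$\langle\gamma|\Phi_{LR}(a)|\gamma\rangle=\langle\gamma_{LL}|a|\gamma_{LL}\rangle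 .$$ -/

import Mathlib

open Filter Topology
open scoped ComplexConjugate

set_option linter.checkUnivs false

universe u v

/-! ## Source manifolds

The path-integral framework takes as given a class of `d`-dimensional source manifolds (manifolds
carrying sources), possibly subject to local restrictions on the sources, together with the
evident geometric operations on them. A `SurfaceCalculus` records this class: for every family
`b i` of closed boundary manifolds, the rimmed source manifolds whose boundary is the disjoint
union of the `b i`; and relabelling of boundary pieces, disjoint union, sewing along pairs of equal
boundary pieces and the reflection `*`, subject to the identities that these operations satisfy
for manifolds. -/

structure SurfaceCalculus where
  /-- Closed boundary manifolds `B`. -/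
  Bdry : Type u
  /-- `Surf b`: rimmed source manifolds whose boundary is the disjoint union of the labelled pieces
  `b i`, up to equivalence. (Only finite `ι` matter; `Surf b` may be empty for infinite `ι`.) -/
  Surf : {ι : Type} → (ι → Bdry) → Type v
  /-- Renaming the labels of the boundary pieces. -/
  relabel : {ι κ : Type} → {b : ι → Bdry} → {c : κ → Bdry} → (e : ι ≃ κ) →
    c ∘ e = b → Surf b → Surf c
  /-- Disjoint union. -/
  union : {ι κ : Type} → {b : ι → Bdry} → {c : κ → Bdry} →
    Surf b → Surf c → Surf (Sum.elim b c)
  /-- The empty manifold. -/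
  empty : Surf (Empty.elim : Empty → Bdry)
  /-- Sewing: for each `k`, the two boundary pieces of type `c k` with labels `inr (inl k)` and
  `inr (inr k)` are identified. -/
  sew : {ι κ : Type} → {b : ι → Bdry} → (c : κ → Bdry) →
    Surf (Sum.elim b (Sum.elim c c)) → Surf b
  /-- The operation `*`: complex conjugation of the sources together with reflection. -/
  star : {ι : Type} → {b : ι → Bdry} → Surf b → Surf b
  /- Relabelling is functorial. -/
  relabel_refl : ∀ {ι : Type} {b : ι → Bdry} (s : Surf b),
    relabel (Equiv.refl ι) (by funext _; rfl) s = s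
  relabel_trans : ∀ {ι κ μ : Type} {b : ι → Bdry} {c : κ → Bdry} {d : μ → Bdry}
    (e : ι ≃ κ) (f : κ ≃ μ) (he : c ∘ e = b) (hf : d ∘ f = c) (s : Surf b),
    relabel f hf (relabel e he s) =
      relabel (e.trans f) (by rw [← he, ← hf]; rfl) s
  /- Disjoint union is natural in the labels, commutative, associative and unital. -/
  union_relabel : ∀ {ι ι' κ κ' : Type} {b : ι → Bdry} {b' : ι' → Bdry} {c : κ → Bdry}
    {c' : κ' → Bdry} (e : ι ≃ ι') (f : κ ≃ κ') (he : b' ∘ e = b)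
    (hf : c' ∘ f = c) (s : Surf b) (t : Surf c),
    union (relabel e he s) (relabel f hf t) =
      relabel (Equiv.sumCongr e f) (by funext i; revert i; rintro (i | k); exacts [congrFun he i, congrFun hf k]) (union s t)
  union_comm : ∀ {ι κ : Type} {b : ι → Bdry} {c : κ → Bdry} (s : Surf b) (t : Surf c),
    union t s = relabel (Equiv.sumComm ι κ) (by funext i; revert i; rintro (_ | _) <;> rfl) (union s t)
  union_assoc : ∀ {ι κ μ : Type} {b : ι → Bdry} {c : κ → Bdry} {d : μ → Bdry}
    (s : Surf b) (t : Surf c) (r : Surf d),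
    union s (union t r) =
      relabel (Equiv.sumAssoc ι κ μ) (by funext i; revert i; rintro ((_ | _) | _) <;> rfl) (union (union s t) r)
  union_empty : ∀ {ι : Type} {b : ι → Bdry} (s : Surf b),
    relabel (Equiv.sumEmpty ι Empty) (by funext i; revert i; rintro (_ | x); exacts [rfl, x.elim])
      (union s empty) = s
  /- Sewing is natural in the labels, symmetric in the two sides of each sewn pair; iterated sewing
  is simultaneous sewing; sewing nothing does nothing; sewing commutes with disjoint union. -/
  sew_relabel : ∀ {ι ι' κ κ' : Type} {b : ι → Bdry} {b' : ι' → Bdry} {c : κ → Bdry}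
    {c' : κ' → Bdry} (e : ι ≃ ι') (f : κ ≃ κ') (he : b' ∘ e = b)
    (hf : c' ∘ f = c) (s : Surf (Sum.elim b (Sum.elim c c))),
    sew c' (relabel (Equiv.sumCongr e (Equiv.sumCongr f f))
      (by funext i; revert i; rintro (i | k | k); exacts [congrFun he i, congrFun hf k, congrFun hf k]) s) = relabel e he (sew c s)
  sew_swap : ∀ {ι κ : Type} {b : ι → Bdry} {c : κ → Bdry} (s : Surf (Sum.elim b (Sum.elim c c))),
    sew c (relabel (Equiv.sumCongr (Equiv.refl ι) (Equiv.sumComm κ κ))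
      (by funext i; revert i; rintro (_ | _ | _) <;> rfl) s) = sew c s
  sew_sew : ∀ {ι κ μ : Type} {b : ι → Bdry} {c : κ → Bdry} {d : μ → Bdry}
    (s : Surf (Sum.elim (Sum.elim b (Sum.elim c c)) (Sum.elim d d))),
    sew c (sew d s) = sew (Sum.elim c d)
      (relabel ((Equiv.sumAssoc ι (κ ⊕ κ) (μ ⊕ μ)).trans
        (Equiv.sumCongr (Equiv.refl ι) (Equiv.sumSumSumComm κ κ μ μ)))
        (by funext i; revert i; rintro ((_ | _ | _) | _ | _) <;> rfl) s)
  sew_empty : ∀ {ι : Type} {b : ι → Bdry} (s : Surf b),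
    sew (Empty.elim : Empty → Bdry)
      (relabel ((Equiv.sumEmpty ι (Empty ⊕ Empty)).symm) (by funext _; rfl) s) = s
  union_sew : ∀ {ι κ μ : Type} {b : ι → Bdry} {c : κ → Bdry} {d : μ → Bdry}
    (s : Surf (Sum.elim b (Sum.elim c c))) (t : Surf d),
    union (sew c s) t = sew c
      (relabel (((Equiv.sumAssoc ι (κ ⊕ κ) μ).trans
        (Equiv.sumCongr (Equiv.refl ι) (Equiv.sumComm (κ ⊕ κ) μ))).trans
          (Equiv.sumAssoc ι μ (κ ⊕ κ)).symm)
        (by funext i; revert i; rintro ((_ | _ | _) | _) <;> rfl) (union s t))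
  /- The reflection is an involution compatible with the other operations. -/
  star_star : ∀ {ι : Type} {b : ι → Bdry} (s : Surf b), star (star s) = s
  star_relabel : ∀ {ι κ : Type} {b : ι → Bdry} {c : κ → Bdry} (e : ι ≃ κ)
    (h : c ∘ e = b) (s : Surf b), star (relabel e h s) = relabel e h (star s)
  star_union : ∀ {ι κ : Type} {b : ι → Bdry} {c : κ → Bdry} (s : Surf b) (t : Surf c),
    star (union s t) = union (star s) (star t)
  star_sew : ∀ {ι κ : Type} {b : ι → Bdry} {c : κ → Bdry}
    (s : Surf (Sum.elim b (Sum.elim c c))), star (sew c s) = sew c (star s)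

namespace SurfaceCalculus

variable (S : SurfaceCalculus.{u, v})

/-- The closed source manifolds. -/
abbrev Closed : Type v := S.Surf (Empty.elim : Empty → S.Bdry)

variable {S} {ι κ μ ν δ : Type} {b : ι → S.Bdry} {c : κ → S.Bdry} {d : μ → S.Bdry}

/-- Gluing two surfaces along a common family `d` of boundary pieces. -/
def glue {d : δ → S.Bdry} (s : S.Surf (Sum.elim b d)) (t : S.Surf (Sum.elim d c)) :
    S.Surf (Sum.elim b c) :=
  S.sew d (S.relabel ((Equiv.sumCongr (Equiv.refl (ι ⊕ δ)) (Equiv.sumComm δ κ)).trans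
    (Equiv.sumSumSumComm ι δ κ δ)) (by funext i; revert i; rintro ((_ | _) | _ | _) <;> rfl) (S.union s t))

/-- The closed manifold `M(s)` obtained from `s`, whose boundary consists of two copies of `c`, by
sewing these two copies together. -/
def closeUp (s : S.Surf (Sum.elim c c)) : S.Closed :=
  S.sew c (S.relabel (Equiv.emptySum Empty (κ ⊕ κ)).symm (by funext _; rfl) s)

/-- The closed manifold obtained by sewing `s^*` to `t` along their whole boundary. -/
def bracket (s t : S.Surf b) : S.Closed := closeUp (S.union (S.star s) t)

/-- Disjoint union of closed manifolds. -/
def closedUnion (M N : S.Closed) : S.Closed :=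
  S.relabel (Equiv.sumEmpty Empty Empty) (by funext i; revert i; rintro (x | x) <;> exact x.elim) (S.union M N)

theorem relabel_congr {e e' : ι ≃ κ} (h : c ∘ e = b) (h' : c ∘ e' = b)
    (he : ∀ i, e i = e' i) (s : S.Surf b) : S.relabel e h s = S.relabel e' h' s := by
  obtain rfl : e = e' := Equiv.ext he
  rfl

theorem closeUp_swap (s : S.Surf (Sum.elim c c)) :
    closeUp (c := c) (S.relabel (Equiv.sumComm κ κ) (by funext i; revert i; rintro (_ | _) <;> rfl) s) =
      closeUp s := by
  unfold closeUp
  conv_rhs => rw [← S.sew_swap]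
  rw [S.relabel_trans, S.relabel_trans]
  congr 1
  exact relabel_congr _ _ (by rintro (_ | _) <;> rfl) _

theorem star_bracket (s t : S.Surf b) : S.star (bracket s t) = bracket t s := by
  unfold bracket
  rw [S.union_comm s (S.star t), closeUp_swap]
  unfold closeUp
  rw [S.star_sew, S.star_relabel, S.star_union, S.star_star]

theorem bracket_star_star (s t : S.Surf b) : bracket (S.star s) (S.star t) = bracket t s := by
  unfold bracket
  rw [S.star_star, S.union_comm (S.star t) s, closeUp_swap]

theorem bracket_relabel (e : ι ≃ κ) (h : c ∘ e = b) (s t : S.Surf b) :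
    bracket (S.relabel e h s) (S.relabel e h t) = bracket s t := by
  unfold bracket closeUp
  rw [S.star_relabel, S.union_relabel, S.relabel_trans]
  have := S.sew_relabel (b := Empty.elim) (b' := Empty.elim) (Equiv.refl Empty) e (by funext x; exact x.elim) h
    (S.relabel (Equiv.emptySum Empty (ι ⊕ ι)).symm (by funext _; rfl) (S.union (S.star s) t))
  rw [S.relabel_trans, S.relabel_refl] at this
  rw [← this]
  congr 1
  exact relabel_congr _ _ (by rintro (_ | _) <;> rfl) _

theorem relabel_sew (e : ι ≃ κ) (h : c ∘ e = b) {f : δ → S.Bdry}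
    (E : μ ≃ ι ⊕ (δ ⊕ δ)) (hE : Sum.elim b (Sum.elim f f) ∘ E = d) (x : S.Surf d) :
    S.relabel e h (S.sew f (S.relabel E hE x)) =
      S.sew f (S.relabel (E.trans (Equiv.sumCongr e (Equiv.refl (δ ⊕ δ))))
        (by rw [← hE, ← h]; funext m; simp only [Function.comp, Equiv.trans_apply]
            rcases E m with _ | _ | _ <;> rfl) x) := by
  rw [← S.sew_relabel e (Equiv.refl δ) h (by funext _; rfl), S.relabel_trans]
  congr 1
  refine relabel_congr _ _ (fun m => ?_) _
  simp only [Equiv.trans_apply]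
  rcases E m with _ | _ | _ <;> rfl

theorem sew_reindex {c' : δ → S.Bdry} (f : κ ≃ δ) (hf : c' ∘ f = c)
    (E : μ ≃ ι ⊕ (κ ⊕ κ)) (E' : μ ≃ ι ⊕ (δ ⊕ δ)) (hE : Sum.elim b (Sum.elim c c) ∘ E = d)
    (hE' : Sum.elim b (Sum.elim c' c') ∘ E' = d)
    (h : ∀ m, E' m = Equiv.sumCongr (Equiv.refl ι) (Equiv.sumCongr f f) (E m)) (x : S.Surf d) :
    S.sew c' (S.relabel E' hE' x) = S.sew c (S.relabel E hE x) := by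
  have := S.sew_relabel (Equiv.refl ι) f (b := b) (by funext _; rfl) hf (S.relabel E hE x)
  rw [S.relabel_refl, S.relabel_trans] at this
  rw [← this]
  congr 1
  exact relabel_congr _ _ (fun m => by rw [h]; rfl) _

theorem sew_relabel_sew {f : ν → S.Bdry} {g : δ → S.Bdry} (F : ι ≃ κ ⊕ (ν ⊕ ν))
    (hF : Sum.elim c (Sum.elim f f) ∘ F = b)
    (E : μ ≃ ι ⊕ (δ ⊕ δ)) (hE : Sum.elim b (Sum.elim g g) ∘ E = d) (x : S.Surf d) :
    S.sew f (S.relabel F hF (S.sew g (S.relabel E hE x))) =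
      S.sew (Sum.elim f g) (S.relabel ((E.trans (Equiv.sumCongr F (Equiv.refl (δ ⊕ δ)))).trans
        ((Equiv.sumAssoc κ (ν ⊕ ν) (δ ⊕ δ)).trans
        (Equiv.sumCongr (Equiv.refl κ) (Equiv.sumSumSumComm ν ν δ δ))))
        (by rw [← hE, ← hF]; funext m; simp only [Function.comp, Equiv.trans_apply]
            rcases E m with i | _ | _
            · simp only [Equiv.sumCongr_apply, Sum.map_inl]
              simp only [Sum.elim_inl, Function.comp]
              rcases F i with _ | _ | _ <;> rfl
            · rfl
            · rfl) x) := by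
  rw [relabel_sew, S.sew_sew, S.relabel_trans]

theorem sew_union (s : S.Surf (Sum.elim b (Sum.elim c c))) (t : S.Surf d) :
    S.union t (S.sew c s) = S.sew c (S.relabel (Equiv.sumAssoc μ ι (κ ⊕ κ)).symm
      (by funext i; revert i; rintro (_ | _ | _ | _) <;> rfl) (S.union t s)) := by
  rw [S.union_comm (S.sew c s) t, S.union_sew, S.union_comm s t, relabel_sew, S.relabel_trans]
  congr 1
  exact relabel_congr _ _ (by rintro ((_ | _ | _) | _) <;> rfl) _

theorem sew_union_sew {d' : δ → S.Bdry} (s : S.Surf (Sum.elim b (Sum.elim c c)))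
    (t : S.Surf (Sum.elim d (Sum.elim d' d'))) :
    S.union (S.sew c s) (S.sew d' t) = S.sew (Sum.elim c d')
      (S.relabel ((Equiv.sumSumSumComm ι (κ ⊕ κ) μ (δ ⊕ δ)).trans
        (Equiv.sumCongr (Equiv.refl (ι ⊕ μ)) (Equiv.sumSumSumComm κ κ δ δ)))
        (by funext i; revert i; rintro ((_ | _ | _) | _ | _ | _) <;> rfl) (S.union s t)) := by
  rw [S.union_sew, sew_union, sew_relabel_sew]
  congr 1
  exact relabel_congr _ _ (by rintro ((_ | _ | _) | _ | _ | _) <;> rfl) _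

theorem union_relabel_left {e : ι ≃ κ} (h : c ∘ e = b) (s : S.Surf b) (t : S.Surf d) :
    S.union (S.relabel e h s) t = S.relabel (Equiv.sumCongr e (Equiv.refl μ))
      (by rw [← h]; funext i; revert i; rintro (_ | _) <;> rfl) (S.union s t) := by
  have := S.union_relabel e (Equiv.refl μ) h (c := d) (by funext _; rfl) s t
  rwa [S.relabel_refl] at this

theorem union_relabel_right {e : ι ≃ κ} (h : c ∘ e = b) (s : S.Surf b) (t : S.Surf d) :
    S.union t (S.relabel e h s) = S.relabel (Equiv.sumCongr (Equiv.refl μ) e)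
      (by rw [← h]; funext i; revert i; rintro (_ | _) <;> rfl) (S.union t s) := by
  have := S.union_relabel (Equiv.refl μ) e (b := d) (by funext _; rfl) h t s
  rwa [S.relabel_refl] at this

theorem union_assoc' (s : S.Surf b) (t : S.Surf c) (r : S.Surf d) :
    S.union (S.union s t) r = S.relabel (Equiv.sumAssoc ι κ μ).symm
      (by funext i; revert i; rintro (_ | _ | _) <;> rfl) (S.union s (S.union t r)) := by
  rw [S.union_assoc, S.relabel_trans]
  conv_lhs => rw [← S.relabel_refl (S.union (S.union s t) r)]
  exact relabel_congr _ _ (by rintro ((_ | _) | _) <;> rfl) _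

/-- Exchange of the second and the fourth surface of a fourfold union. -/
theorem union_exchange (p : S.Surf b) (q : S.Surf c) (r : S.Surf d) {f : δ → S.Bdry}
    (t : S.Surf f) : S.union (S.union p t) (S.union r q) =
      S.relabel ((Equiv.sumCongr (Equiv.refl _) (Equiv.sumComm μ δ)).trans
        ((Equiv.sumSumSumComm ι κ δ μ).trans
          (Equiv.sumCongr (Equiv.refl _) (Equiv.sumComm κ μ))))
        (by funext i; revert i; rintro ((_ | _) | _ | _) <;> rfl)
        (S.union (S.union p q) (S.union r t)) := by
  have h : S.union t (S.union r q) = S.relabel ((Equiv.sumAssoc κ μ δ).symm.trans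
      ((Equiv.sumComm _ _).trans (Equiv.sumCongr (Equiv.refl δ) (Equiv.sumComm κ μ))))
      (by funext i; revert i; rintro (_ | _ | _) <;> rfl) (S.union q (S.union r t)) := by
    rw [S.union_assoc q r t, S.union_comm q r, union_relabel_right, S.union_comm (S.union q r) t,
      S.relabel_trans, S.relabel_trans]
    exact relabel_congr _ _ (by rintro ((_ | _) | _) <;> rfl) _
  rw [union_assoc' p t, h, union_relabel_right, S.union_assoc p q, S.relabel_trans,
    S.relabel_trans]
  exact relabel_congr _ _ (by rintro ((_ | _) | _ | _) <;> rfl) _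

theorem union_middle (p : S.Surf b) (q : S.Surf c) (r : S.Surf d) {f : δ → S.Bdry}
    (t : S.Surf f) : S.union (S.union p r) (S.union q t) =
      S.relabel (Equiv.sumSumSumComm ι κ μ δ)
        (by funext i; revert i; rintro ((_ | _) | _ | _) <;> rfl)
        (S.union (S.union p q) (S.union r t)) := by
  rw [S.union_comm t q, union_relabel_right, union_exchange p q t r, S.union_comm r t,
    union_relabel_right, S.relabel_trans, S.relabel_trans]
  exact relabel_congr _ _ (by rintro ((_ | _) | _ | _) <;> rfl) _

theorem bracket_union (s s' : S.Surf b) (t t' : S.Surf c) :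
    bracket (S.union s t) (S.union s' t') = closedUnion (bracket s s') (bracket t t') := by
  unfold bracket closedUnion closeUp
  rw [sew_union_sew, S.union_relabel, S.relabel_trans, relabel_sew, S.star_union,
    union_middle (S.star s), S.relabel_trans]
  congr 1
  exact relabel_congr _ _ (by rintro ((_ | _) | _ | _) <;> rfl) _

/-- Sewing is insensitive to interchanging the two sides of only some of the sewn pairs. -/
theorem sew_swap_right {f : δ → S.Bdry}
    (E : μ ≃ ι ⊕ ((κ ⊕ δ) ⊕ (κ ⊕ δ)))
    (hE : Sum.elim b (Sum.elim (Sum.elim c f) (Sum.elim c f)) ∘ E = d) (x : S.Surf d) :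
    S.sew (Sum.elim c f) (S.relabel (E.trans (Equiv.sumCongr (Equiv.refl ι)
      ((Equiv.sumSumSumComm κ δ κ δ).trans ((Equiv.sumCongr (Equiv.refl (κ ⊕ κ))
        (Equiv.sumComm δ δ)).trans (Equiv.sumSumSumComm κ κ δ δ)))))
      (by rw [← hE]; funext m; simp only [Function.comp, Equiv.trans_apply]
          rcases E m with _ | (_ | _) | _ | _ <;> rfl) x) =
    S.sew (Sum.elim c f) (S.relabel E hE x) := by
  have key : ∀ y : S.Surf (Sum.elim (Sum.elim b (Sum.elim c c)) (Sum.elim f f)), 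
      S.sew (Sum.elim c f) (S.relabel (((Equiv.sumCongr (Equiv.refl _) (Equiv.sumComm δ δ))).trans 
        ((Equiv.sumAssoc ι (κ ⊕ κ) (δ ⊕ δ)).trans
        (Equiv.sumCongr (Equiv.refl ι) (Equiv.sumSumSumComm κ κ δ δ))))
        (by funext i; revert i; rintro ((_ | _ | _) | _ | _) <;> rfl) y) = 
      S.sew (Sum.elim c f) (S.relabel 
        ((Equiv.sumAssoc ι (κ ⊕ κ) (δ ⊕ δ)).trans
        (Equiv.sumCongr (Equiv.refl ι) (Equiv.sumSumSumComm κ κ δ δ)))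
        (by funext i; revert i; rintro ((_ | _ | _) | _ | _) <;> rfl) y) := by
    intro y
    rw [← S.sew_sew, ← S.sew_swap y, S.sew_sew, S.relabel_trans]
  have := key (S.relabel (E.trans ((Equiv.sumAssoc ι (κ ⊕ κ) (δ ⊕ δ)).trans
        (Equiv.sumCongr (Equiv.refl ι) (Equiv.sumSumSumComm κ κ δ δ))).symm)
        (by rw [← hE]; funext m; simp only [Function.comp, Equiv.trans_apply]
            rcases E m with _ | (_ | _) | _ | _ <;> rfl) x)
  rw [S.relabel_trans, S.relabel_trans] at this
  convert this using 2
  · refine relabel_congr _ _ (fun m => ?_) _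
    simp only [Equiv.trans_apply]
    rcases E m with _ | (_ | _) | _ | _ <;> rfl
  · refine relabel_congr _ _ (fun m => ?_) _
    simp only [Equiv.trans_apply]
    rcases E m with _ | (_ | _) | _ | _ <;> rfl

/-- Exchange of the two copies of `δ` among the labels of a surface. -/
def exch (ι δ κ : Type) : (ι ⊕ δ) ⊕ (δ ⊕ κ) ≃ (ι ⊕ δ) ⊕ (δ ⊕ κ) where
  toFun := Sum.elim (Sum.elim (Sum.inl ∘ Sum.inl) (Sum.inr ∘ Sum.inl))
    (Sum.elim (Sum.inl ∘ Sum.inr) (Sum.inr ∘ Sum.inr))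
  invFun := Sum.elim (Sum.elim (Sum.inl ∘ Sum.inl) (Sum.inr ∘ Sum.inl))
    (Sum.elim (Sum.inl ∘ Sum.inr) (Sum.inr ∘ Sum.inr))
  left_inv := by rintro ((_ | _) | _ | _) <;> rfl
  right_inv := by rintro ((_ | _) | _ | _) <;> rfl

theorem bracket_glue {f : δ → S.Bdry} (s s' : S.Surf (Sum.elim b f)) (t t' : S.Surf (Sum.elim f c)) :
    bracket (glue s t') (glue s' t) =
      bracket (S.union s (S.star t)) (S.relabel (exch ι δ κ)
        (by funext i; revert i; rintro ((_ | _) | _ | _) <;> rfl) (S.union s' (S.star t'))) := by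
  unfold bracket glue closeUp
  rw [S.star_sew, S.star_relabel, S.star_union, sew_union_sew, S.union_relabel, S.relabel_trans,
    sew_relabel_sew, union_relabel_right, S.relabel_trans, S.star_union, S.star_star,
    union_exchange (S.star s) (S.star t'), S.relabel_trans]
  conv_rhs => rw [← sew_swap_right]
  symm
  refine sew_reindex ((Equiv.sumSumSumComm ι κ δ δ).trans
    (Equiv.sumCongr (Equiv.refl _) (Equiv.sumComm κ δ))) ?_ _ _ _ _ ?_ _
  · funext i; rcases i with (_ | _) | _ | _ <;> rfl
  · rintro (((_ | _) | _ | _) | (_ | _) | _ | _) <;> rfl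

/-- Bilinear extension of `glue` to formal finite linear combinations. -/
noncomputable def glueComb {f : δ → S.Bdry} :
    (S.Surf (Sum.elim b f) →₀ ℂ) →ₗ[ℂ] (S.Surf (Sum.elim f c) →₀ ℂ) →ₗ[ℂ]
      (S.Surf (Sum.elim b c) →₀ ℂ) :=
  Finsupp.lift _ ℂ _ fun s => Finsupp.lmapDomain ℂ ℂ (glue s)

theorem glueComb_single {f : δ → S.Bdry} (s : S.Surf (Sum.elim b f)) (t : S.Surf (Sum.elim f c)) :
    glueComb (Finsupp.single s 1) (Finsupp.single t 1) = Finsupp.single (glue s t) 1 := by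
  simp [glueComb, Finsupp.mapDomain_single]

end SurfaceCalculus

/-- Source manifolds with their cylinders. Every surface is rimmed: near each piece `B` of its
boundary it coincides with a cylinder `B × [0, ε]`. -/
structure SourceManifolds extends SurfaceCalculus.{u, v} where
  /-- The cylinder `C_β = B × [0, β]` of length `β`; only `β > 0` is meaningful. -/
  cyl : (B : Bdry) → ℝ → Surf (Sum.elim (fun _ : Unit => B) (fun _ : Unit => B))
  cyl_star : ∀ (B : Bdry) (β : ℝ), 0 < β → star (cyl B β) = cyl B β
  cyl_swap : ∀ (B : Bdry) (β : ℝ), 0 < β →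
    relabel (Equiv.sumComm Unit Unit) (by funext i; revert i; rintro (_ | _) <;> rfl) (cyl B β) =
      cyl B β
  cyl_glue : ∀ (B : Bdry) (α β : ℝ), 0 < α → 0 < β →
    SurfaceCalculus.glue (S := toSurfaceCalculus) (cyl B α) (cyl B β) = cyl B (α + β)
  rim : ∀ {κ : Type} (B : Bdry) (c : κ → Bdry) (s : Surf (Sum.elim (fun _ : Unit => B) c)),
    ∃ ε : ℝ, 0 < ε ∧ ∃ t : Surf (Sum.elim (fun _ : Unit => B) c),
      s = SurfaceCalculus.glue (S := toSurfaceCalculus) (cyl B ε) t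

namespace SourceManifolds
variable (S : SourceManifolds.{u, v})

/-- The boundary `B ⊔ B'` with left piece `B` and right piece `B'`. -/
abbrev two (B B' : S.Bdry) : Unit ⊕ Unit → S.Bdry :=
  Sum.elim (fun _ => B) (fun _ => B')

end SourceManifolds

/-- A Euclidean path integral: a map `ζ` from closed source manifolds to `ℂ` that satisfies the
axioms of reality, reflection positivity, continuity and factorization (finiteness is the fact that
`ζ` is everywhere defined). -/
structure PathIntegral (S : SourceManifolds.{u, v}) where
  zeta : S.Closed → ℂ
  reality : ∀ M : S.Closed, zeta (S.star M) = conj (zeta M)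
  reflection_positivity : ∀ {ι : Type} {b : ι → S.Bdry} (n : ℕ) (γ : Fin n → ℂ)
    (N : Fin n → S.Surf b),
    0 ≤ (∑ I, ∑ J, conj (γ I) * γ J * zeta (SurfaceCalculus.bracket (N I) (N J))).re ∧
      (∑ I, ∑ J, conj (γ I) * γ J * zeta (SurfaceCalculus.bracket (N I) (N J))).im = 0
  /-- If a closed manifold contains a cylinder `C_ε`, then `ζ` is continuous in its length. Here `N`
  is the complement of the cylinder. -/
  continuity : ∀ (B : S.Bdry) (N : S.Surf (S.two B B)),
    ContinuousOn (fun ε => zeta (SurfaceCalculus.closeUp (SurfaceCalculus.glue (S.cyl B ε) N)))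
      (Set.Ioi 0)
  factorization : ∀ M M' : S.Closed,
    zeta (SurfaceCalculus.closedUnion M M') = zeta M * zeta M'

open UniformSpace (Completion)

/-- Extension of a bounded bilinear map to the completions (with the arguments flipped). -/
noncomputable def bilinExtend {E₁ E₂ F : Type*} [SeminormedAddCommGroup E₁] [NormedSpace ℂ E₁]
    [SeminormedAddCommGroup E₂] [NormedSpace ℂ E₂] [NormedAddCommGroup F] [NormedSpace ℂ F]
    [CompleteSpace F] (B : E₁ →L[ℂ] E₂ →L[ℂ] F) : Completion E₂ →L[ℂ] Completion E₁ →L[ℂ] F :=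
  (B.extend (Completion.toComplL (𝕜 := ℂ) (E := E₁))).flip.extend
    (Completion.toComplL (𝕜 := ℂ) (E := E₂))

theorem bilinExtend_coe {E₁ E₂ F : Type*} [SeminormedAddCommGroup E₁] [NormedSpace ℂ E₁]
    [SeminormedAddCommGroup E₂] [NormedSpace ℂ E₂] [NormedAddCommGroup F] [NormedSpace ℂ F]
    [CompleteSpace F] (B : E₁ →L[ℂ] E₂ →L[ℂ] F) (x : E₁) (y : E₂) :
    bilinExtend B (y : Completion E₂) (x : Completion E₁) = B x y := by
  have h₁ := (B.extend (Completion.toComplL (𝕜 := ℂ) (E := E₁))).flip.extend_eq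
    (e := Completion.toComplL (𝕜 := ℂ) (E := E₂)) Completion.denseRange_coe
    (Completion.isUniformInducing_coe _) y
  have h₂ := B.extend_eq (e := Completion.toComplL (𝕜 := ℂ) (E := E₁)) Completion.denseRange_coe
    (Completion.isUniformInducing_coe _) x
  exact (DFunLike.congr_fun h₁ (x : Completion E₁)).trans (DFunLike.congr_fun h₂ y)

namespace PathIntegral

open SurfaceCalculus

variable {S : SourceManifolds.{u, v}} (P : PathIntegral S)
variable {ι κ δ : Type} 

/-- The space `H_𝓑` of formal finite linear combinations of rimmed surfaces with boundary `b`. -/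
def Comb (_P : PathIntegral S) (b : ι → S.Bdry) : Type v := S.Surf b →₀ ℂ

noncomputable instance (b : ι → S.Bdry) : AddCommGroup (P.Comb b) :=
  inferInstanceAs (AddCommGroup (S.Surf b →₀ ℂ))

noncomputable instance (b : ι → S.Bdry) : Module ℂ (P.Comb b) :=
  inferInstanceAs (Module ℂ (S.Surf b →₀ ℂ))

/-- A surface as an element of `H_𝓑`. -/
noncomputable def single {b : ι → S.Bdry} (s : S.Surf b) : P.Comb b := Finsupp.single s (1 : ℂ)

/-- The sesquilinear form `⟨f|g⟩` with `⟨s|t⟩ = ζ(M_{s^* t})`. -/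
noncomputable def form {b : ι → S.Bdry} (f g : S.Surf b →₀ ℂ) : ℂ :=
  f.sum fun s z => g.sum fun t w => conj z * w * P.zeta (bracket s t)

theorem zeta_bracket_conj {b : ι → S.Bdry} (s t : S.Surf b) :
    conj (P.zeta (bracket s t)) = P.zeta (bracket t s) := by
  rw [← P.reality, star_bracket]

theorem form_conj {b : ι → S.Bdry} (f g : S.Surf b →₀ ℂ) : conj (P.form g f) = P.form f g := by
  unfold form Finsupp.sum
  simp only [map_sum]
  rw [Finset.sum_comm]
  refine Finset.sum_congr rfl fun s _ => Finset.sum_congr rfl fun t _ => ?_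
  simp only [map_mul, zeta_bracket_conj, Complex.conj_conj]
  ring

theorem form_nonneg {b : ι → S.Bdry} (f : S.Surf b →₀ ℂ) : 0 ≤ (P.form f f).re := by
  have h := (P.reflection_positivity f.support.card
    (fun i => f (f.support.equivFin.symm i)) (fun i => (f.support.equivFin.symm i : S.Surf b))).1
  have h2 : ∀ F : S.Surf b → ℂ, ∑ i : Fin f.support.card, F (f.support.equivFin.symm i) =
      ∑ s ∈ f.support, F s := fun F => by
    rw [Equiv.sum_comp f.support.equivFin.symm (fun x => F x), Finset.sum_coe_sort f.support F]
  rw [h2 (fun s => ∑ J, conj (f s) * f (f.support.equivFin.symm J) *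
    P.zeta (bracket s (f.support.equivFin.symm J)))] at h
  refine h.trans_eq (congrArg Complex.re (Finset.sum_congr rfl fun s _ => ?_))
  exact h2 (fun t => conj (f s) * f t * P.zeta (bracket s t))

theorem form_add_left {b : ι → S.Bdry} (f g h : S.Surf b →₀ ℂ) :
    P.form (f + g) h = P.form f h + P.form g h := by
  classical
  unfold form
  refine Finsupp.sum_add_index' (fun s => by simp) fun s z w => ?_
  simp only [Finsupp.sum, map_add, add_mul, Finset.sum_add_distrib]

theorem form_smul_left {b : ι → S.Bdry} (f g : S.Surf b →₀ ℂ) (r : ℂ) :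
    P.form (r • f) g = conj r * P.form f g := by
  unfold form
  rw [Finsupp.sum_smul_index (fun s => by simp)]
  simp only [Finsupp.sum, map_mul, Finset.mul_sum, mul_assoc]

/-- The pre-inner product on `H_𝓑`. -/
@[reducible]
noncomputable def core (b : ι → S.Bdry) : PreInnerProductSpace.Core ℂ (P.Comb b) where
  inner := P.form
  conj_inner_symm f g := P.form_conj f g
  re_inner_nonneg f := P.form_nonneg f
  add_left f g h := P.form_add_left f g h
  smul_left f g r := P.form_smul_left f g r

noncomputable instance (b : ι → S.Bdry) : SeminormedAddCommGroup (P.Comb b) :=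
  @InnerProductSpace.Core.toSeminormedAddCommGroup ℂ _ _ _ _ (P.core b)

noncomputable instance (b : ι → S.Bdry) : InnerProductSpace ℂ (P.Comb b) :=
  InnerProductSpace.ofCore (P.core b)

theorem inner_eq {b : ι → S.Bdry} (f g : P.Comb b) : inner ℂ f g = P.form f g := rfl

theorem inner_single {b : ι → S.Bdry} (s t : S.Surf b) :
    inner ℂ (P.single s) (P.single t) = P.zeta (bracket s t) := by
  rw [inner_eq]
  simp [form, single]

theorem inner_sum_single {b : ι → S.Bdry} {σ τ : Type*} (F : Finset σ) (G : Finset τ)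
    (z : σ → ℂ) (w : τ → ℂ) (s : σ → S.Surf b) (t : τ → S.Surf b) :
    inner ℂ (∑ i ∈ F, z i • P.single (s i)) (∑ j ∈ G, w j • P.single (t j)) =
      ∑ i ∈ F, ∑ j ∈ G, conj (z i) * w j * P.zeta (bracket (s i) (t j)) := by
  rw [sum_inner]
  refine Finset.sum_congr rfl fun i _ => ?_
  rw [inner_sum]
  refine Finset.sum_congr rfl fun j _ => ?_
  rw [inner_smul_left, inner_smul_right, inner_single, mul_assoc]

theorem eq_sum_single {b : ι → S.Bdry} (f : P.Comb b) :
    ∃ (F : Finset (S.Surf b)) (z : S.Surf b → ℂ), f = ∑ s ∈ F, z s • P.single s := by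
  refine ⟨Finsupp.support f, fun s => (show S.Surf b →₀ ℂ from f) s, ?_⟩
  conv_lhs => rw [← Finsupp.sum_single (show S.Surf b →₀ ℂ from f)]
  refine Finset.sum_congr rfl fun s _ => ?_
  exact (Finsupp.smul_single_one s _).symm

/-- Gluing `(f, g) ↦ f g` of formal linear combinations. -/
noncomputable def glueₗ {b : ι → S.Bdry} {d : δ → S.Bdry} {c : κ → S.Bdry} :
    P.Comb (Sum.elim b d) →ₗ[ℂ] P.Comb (Sum.elim d c) →ₗ[ℂ] P.Comb (Sum.elim b c) :=
  glueComb

section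
variable {b : ι → S.Bdry} {d : δ → S.Bdry} {c : κ → S.Bdry}

theorem glueₗ_single (s : S.Surf (Sum.elim b d)) (t : S.Surf (Sum.elim d c)) :
    P.glueₗ (P.single s) (P.single t) = P.single (glue s t) :=
  glueComb_single s t

/-- The trace inequality. -/
theorem norm_glueₗ_le (f : P.Comb (Sum.elim b d)) (g : P.Comb (Sum.elim d c)) :
    ‖P.glueₗ f g‖ ≤ ‖f‖ * ‖g‖ := by
  obtain ⟨F, z, hf⟩ := P.eq_sum_single f
  obtain ⟨G, w, hg⟩ := P.eq_sum_single g
  set ψ : P.Comb (Sum.elim (Sum.elim b d) (Sum.elim d c)) :=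
    ∑ i ∈ F ×ˢ G, (z i.1 * conj (w i.2)) • P.single (S.union i.1 (S.star i.2)) with hψ
  set ψ' : P.Comb (Sum.elim (Sum.elim b d) (Sum.elim d c)) :=
    ∑ i ∈ F ×ˢ G, (z i.1 * conj (w i.2)) • P.single (S.relabel (exch ι δ κ)
        (by funext i; revert i; rintro ((_ | _) | _ | _) <;> rfl) (S.union i.1 (S.star i.2)))
    with hψ'
  have hfg : P.glueₗ f g = ∑ i ∈ F ×ˢ G, (z i.1 * w i.2) • P.single (glue i.1 i.2) := by
    rw [hf, hg, Finset.sum_product]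
    simp only [map_sum, LinearMap.sum_apply, map_smul, LinearMap.smul_apply, glueₗ_single,
      Finset.smul_sum, smul_smul]
    rw [Finset.sum_comm]
    simp only [mul_comm]
  have h1 : inner ℂ (P.glueₗ f g) (P.glueₗ f g) = inner ℂ ψ ψ' := by
    rw [hfg, hψ, hψ', inner_sum_single, inner_sum_single]
    simp only [Finset.sum_product]
    refine Finset.sum_congr rfl fun s _ => ?_
    rw [Finset.sum_comm]
    conv_rhs => rw [Finset.sum_comm]
    refine Finset.sum_congr rfl fun s' _ => ?_
    rw [Finset.sum_comm]
    refine Finset.sum_congr rfl fun t _ => Finset.sum_congr rfl fun t' _ => ?_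
    rw [bracket_glue s s' t t']
    simp only [map_mul, Complex.conj_conj]
    ring
  have h2 : inner ℂ ψ ψ = inner ℂ f f * inner ℂ g g := by
    rw [hψ, inner_sum_single]
    rw [hf, hg, inner_sum_single, inner_sum_single]
    simp only [Finset.sum_product, Finset.sum_mul_sum]
    refine Finset.sum_congr rfl fun s _ => ?_
    rw [Finset.sum_comm]
    conv_rhs => rw [Finset.sum_comm]
    refine Finset.sum_congr rfl fun s' _ => ?_
    rw [Finset.sum_comm]
    refine Finset.sum_congr rfl fun t _ => Finset.sum_congr rfl fun t' _ => ?_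
    rw [bracket_union, P.factorization, bracket_star_star]
    simp only [map_mul, Complex.conj_conj]
    ring
  have h3 : inner ℂ ψ' ψ' = inner ℂ ψ ψ := by
    rw [hψ', hψ, inner_sum_single, inner_sum_single]
    simp only [bracket_relabel]
  have e1 : ‖ψ‖ = ‖f‖ * ‖g‖ := by
    have : ‖ψ‖ ^ 2 = (‖f‖ * ‖g‖) ^ 2 := by
      rw [mul_pow]
      rw [inner_self_eq_norm_sq_to_K, inner_self_eq_norm_sq_to_K, inner_self_eq_norm_sq_to_K] at h2
      exact_mod_cast h2
    exact (sq_eq_sq₀ (norm_nonneg _) (by positivity)).1 this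
  have e2 : ‖ψ'‖ = ‖ψ‖ := by
    rw [inner_self_eq_norm_sq_to_K, inner_self_eq_norm_sq_to_K] at h3
    exact (sq_eq_sq₀ (norm_nonneg _) (norm_nonneg _)).1 (by exact_mod_cast h3)
  have e3 : ‖P.glueₗ f g‖ ^ 2 ≤ (‖f‖ * ‖g‖) ^ 2 := by
    have h4 := norm_inner_le_norm (𝕜 := ℂ) ψ ψ'
    rw [← h1, inner_self_eq_norm_sq_to_K, e2, e1] at h4
    rw [sq (‖f‖ * ‖g‖)]
    simpa using h4
  exact (sq_le_sq₀ (norm_nonneg _) (by positivity)).1 e3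
end

noncomputable section Hilbert

/-- The Hilbert space `ℋ_𝓑`: the (Hausdorff) completion of `H_𝓑`, that is, the completion of the
quotient of `H_𝓑` by its null vectors. -/
abbrev Hilb (b : ι → S.Bdry) : Type v := Completion (P.Comb b)

/-- The vector `|f⟩` defined by `f ∈ H_𝓑`. -/
def ket {b : ι → S.Bdry} (f : P.Comb b) : P.Hilb b := (f : Completion (P.Comb b))

section
variable {b : ι → S.Bdry} {d : δ → S.Bdry} {c : κ → S.Bdry}

/-- `(f, g) ↦ |f g⟩`. -/
def glueKet : P.Comb (Sum.elim b d) →L[ℂ] P.Comb (Sum.elim d c) →L[ℂ] P.Hilb (Sum.elim b c) :=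
  (ContinuousLinearMap.compL ℂ _ _ _ (Completion.toComplL (𝕜 := ℂ))).comp
    (P.glueₗ.mkContinuous₂ 1 fun f g => by simpa using P.norm_glueₗ_le f g)

/-- The operator `Ψ_R |ψ⟩ = ψ̂_R`, gluing `ψ` on the right; the unique continuous extension of
`Ψ_R |g⟩ |f⟩ = |f g⟩`. -/
def PsiR : P.Hilb (Sum.elim d c) →L[ℂ] P.Hilb (Sum.elim b d) →L[ℂ] P.Hilb (Sum.elim b c) :=
  bilinExtend P.glueKet

theorem PsiR_ket_ket (f : P.Comb (Sum.elim b d)) (g : P.Comb (Sum.elim d c)) :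
    P.PsiR (P.ket g) (P.ket f) = P.ket (P.glueₗ f g) :=
  bilinExtend_coe P.glueKet f g

end

/-- The representation on `ℋ_{B ⊔ B'}` of an element `a` of the left surface algebra of `B`: the
bounded operator `â_L` with `â_L |f⟩ = |a f⟩`. -/
def leftOp {B : S.Bdry} (B' : S.Bdry) (a : P.Comb (S.two B B)) :
    P.Hilb (S.two B B') →L[ℂ] P.Hilb (S.two B B') :=
  P.PsiR.flip (P.ket a)

theorem leftOp_ket {B : S.Bdry} (B' : S.Bdry) (a : P.Comb (S.two B B))
    (f : P.Comb (S.two B B')) : P.leftOp B' a (P.ket f) = P.ket (P.glueₗ a f) :=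
  P.PsiR_ket_ket a f

/-- The left von Neumann algebra on `ℋ_{B ⊔ B'}`: the closure of the represented surface algebra in
the weak operator topology. -/
def vonNeumannL (B B' : S.Bdry) : Set (P.Hilb (S.two B B') →L[ℂ] P.Hilb (S.two B B')) :=
  {T | ContinuousLinearMapWOT.ofCLM T ∈
    closure (Set.range fun a : P.Comb (S.two B B) => ContinuousLinearMapWOT.ofCLM (P.leftOp B' a))}

/-- The vector `|C_β⟩ ∈ ℋ_{B ⊔ B}`. -/
def cylKet (B : S.Bdry) (β : ℝ) : P.Hilb (S.two B B) := P.ket (P.single (S.cyl B β))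

/-- `T` is a bounded operator on `ℋ_{LR}` with `T |C_ε φ⟩ = φ̂_R a |C_ε⟩` for all `ε > 0` and all
`φ ∈ H_{LR}`. As surfaces are rimmed, every vector of the dense subspace `𝒟_{LR}` is of the form
`|C_ε φ⟩` for all sufficiently small `ε`. -/
def IsPhi (BL BR : S.Bdry) (a : P.Hilb (S.two BL BL) →L[ℂ] P.Hilb (S.two BL BL))
    (T : P.Hilb (S.two BL BR) →L[ℂ] P.Hilb (S.two BL BR)) : Prop :=
  ∀ ε : ℝ, 0 < ε → ∀ φ : P.Comb (S.two BL BR),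
    T (P.ket (P.glueₗ (P.single (S.cyl BL ε)) φ)) = P.PsiR (P.ket φ) (a (P.cylKet BL ε))

open scoped Classical in
/-- The operator `Φ_{LR}(a)` on `ℋ_{LR}`, characterized by `IsPhi`. -/
def Phi (BL BR : S.Bdry) (a : P.Hilb (S.two BL BL) →L[ℂ] P.Hilb (S.two BL BL)) :
    P.Hilb (S.two BL BR) →L[ℂ] P.Hilb (S.two BL BR) :=
  if h : ∃ T, P.IsPhi BL BR a T then h.choose else 0

/-- The positive square root `|γ̂_R|` of `γ̂_R† γ̂_R`, an operator on `ℋ_{LL}`. -/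
def absPsiR (BL BR : S.Bdry) (γ : P.Hilb (S.two BL BR)) :
    P.Hilb (S.two BL BL) →L[ℂ] P.Hilb (S.two BL BL) :=
  CFC.sqrt (ContinuousLinearMap.adjoint (P.PsiR (b := fun _ : Unit => BL) γ) ∘L
    P.PsiR (b := fun _ : Unit => BL) γ)

end Hilbert

end PathIntegral

/-! Read `|C_β⟩` as an approximate unit: gluing a cylinder to `γ` on the left gives `γ̂_R|C_β⟩`,
which tends to `γ` as `β ↓ 0` (`tendsto_PsiR_cylKet`), although `|C_β⟩` itself need not converge. An
operator `a` of the left algebra commutes with everything built from right gluing: with `γ̂_R†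
γ̂_R`, since this commutes with left gluing of surfaces, and hence with `|γ̂_R|` (`absPsiR_comm`).

At each `β > 0` the claimed identity is then algebra: `⟨γ̂_R C_β|Φ(a) γ̂_R C_β⟩ = ⟨γ̂_R C_β|γ̂_R a
C_β⟩ = ⟨|γ̂_R| C_β| |γ̂_R| a C_β⟩ = ⟨|γ̂_R| C_β|a |γ̂_R| C_β⟩`, and `β ↓ 0` gives the result. The
vectors `|γ̂_R| C_β` converge because `|γ̂_R|` and `γ̂_R` give equal norms.

`Φ(a)` is the strong limit of `x ↦ x̂_R a|C_β⟩` (`exists_isPhi`). The commutation yields `‖x̂_R a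
C_β‖ ≤ ‖a‖ ‖x̂_R C_β‖`, so uniform boundedness reduces to that of the cylinder semigroup near zero
length (`exists_norm_PsiR_cylKet_le`). -/

namespace SurfaceCalculus

/-! ### Gluing as an associative product with adjoint and trace. -/

variable {S : SurfaceCalculus.{u, v}}
variable {ι κ μ δ : Type} {b : ι → S.Bdry} {c : κ → S.Bdry} {d : μ → S.Bdry} {f : δ → S.Bdry}

/-- Both sides are one simultaneous sewing of the threefold union along `d` and `f`; only the order
of the two families differs. -/
theorem glue_assoc (s : S.Surf (Sum.elim b d)) (t : S.Surf (Sum.elim d f))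
    (r : S.Surf (Sum.elim f c)) : glue (glue s t) r = glue s (glue t r) := by
  unfold glue
  rw [S.union_sew, sew_union, union_relabel_left, union_relabel_right, S.union_assoc,
    S.relabel_trans, S.relabel_trans, S.relabel_trans, sew_relabel_sew, sew_relabel_sew]
  refine sew_reindex (Equiv.sumComm μ δ) ?_ _ _ _ _ ?_ _
  · funext i; rcases i with _ | _ <;> rfl
  · rintro (((_ | _) | _ | _) | _ | _) <;> rfl

/-- The reflection `*` followed by the exchange of the two sides of the boundary. -/
def dagger (s : S.Surf (Sum.elim b c)) : S.Surf (Sum.elim c b) :=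
  S.relabel (Equiv.sumComm ι κ) (by funext i; revert i; rintro (_ | _) <;> rfl) (S.star s)

theorem dagger_glue (s : S.Surf (Sum.elim b d)) (t : S.Surf (Sum.elim d c)) :
    dagger (glue s t) = glue (dagger t) (dagger s) := by
  unfold dagger glue
  rw [S.star_sew, S.star_relabel, S.star_union, S.union_relabel, S.union_comm (S.star s) (S.star t),
    S.relabel_trans, S.relabel_trans, relabel_sew, ← S.sew_swap, S.relabel_trans]
  congr 1
  exact relabel_congr _ _ (by rintro ((_ | _) | _ | _) <;> rfl) _

/-- Cyclicity of the trace: either way `s ⊔ t` is sewn along both `b` and `c`. -/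
theorem closeUp_glue_comm (s : S.Surf (Sum.elim b c)) (t : S.Surf (Sum.elim c b)) :
    closeUp (glue s t) = closeUp (glue t s) := by
  unfold closeUp glue
  rw [S.union_comm s t, S.relabel_trans, sew_relabel_sew, sew_relabel_sew, ← S.sew_swap,
    S.relabel_trans]
  symm
  refine sew_reindex (Equiv.sumComm ι κ) ?_ _ _ _ _ ?_ _
  · funext i; rcases i with _ | _ <;> rfl
  · rintro ((_ | _) | _ | _) <;> rfl

/-- The Hilbert–Schmidt form of the bracket, `tr (t s†)`; with cyclicity it produces adjoints. -/
theorem bracket_eq_closeUp (s t : S.Surf (Sum.elim b c)) :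
    bracket s t = closeUp (glue t (dagger s)) := by
  unfold bracket closeUp glue dagger
  rw [union_relabel_right, S.union_comm (S.star s) t, S.relabel_trans, S.relabel_trans,
    sew_relabel_sew, ← S.sew_swap, S.relabel_trans]
  congr 1
  exact relabel_congr _ _ (by rintro ((_ | _) | _ | _) <;> rfl) _

/-- The adjoint of gluing `a` on the left is gluing `dagger a` on the left. -/
theorem bracket_glue_left (a : S.Surf (Sum.elim b d)) (s : S.Surf (Sum.elim d c))
    (t : S.Surf (Sum.elim b c)) : bracket (glue a s) t = bracket s (glue (dagger a) t) := by
  -- `tr (t (a s)†) = tr (t s† a†) = tr (a† t s†)`.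
  rw [bracket_eq_closeUp, bracket_eq_closeUp, dagger_glue, ← glue_assoc, closeUp_glue_comm,
    glue_assoc]

end SurfaceCalculus

/-! ### Gluing operators on the completed spaces. -/

namespace PathIntegral

open SurfaceCalculus

noncomputable section

variable {S : SourceManifolds.{u, v}} (P : PathIntegral S)
variable {ι κ μ δ : Type} {b : ι → S.Bdry} {c : κ → S.Bdry} {d : μ → S.Bdry} {f : δ → S.Bdry}

theorem denseRange_ket : DenseRange (P.ket (b := b)) := Completion.denseRange_coe

theorem norm_ket (x : P.Comb b) : ‖P.ket x‖ = ‖x‖ := Completion.norm_coe x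

theorem inner_ket (x y : P.Comb b) : inner ℂ (P.ket x) (P.ket y) = inner ℂ x y :=
  Completion.inner_coe x y

theorem mem_of_ket_single_mem (V : Submodule ℂ (P.Hilb b)) (hV : IsClosed (V : Set (P.Hilb b)))
    (h : ∀ s : S.Surf b, P.ket (P.single s) ∈ V) (x : P.Hilb b) : x ∈ V := by
  refine P.denseRange_ket.induction_on x hV fun y => ?_
  obtain ⟨F, z, rfl⟩ := P.eq_sum_single y
  change (Completion.toComplL (𝕜 := ℂ) (E := P.Comb b)) _ ∈ V
  rw [map_sum]
  refine Submodule.sum_mem _ fun s _ => ?_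
  rw [map_smul]
  exact Submodule.smul_mem _ _ (h s)

/-- Bounded operators that agree on all surfaces are equal. -/
theorem clm_ext {F : Type*} [NormedAddCommGroup F] [NormedSpace ℂ F] {T T' : P.Hilb b →L[ℂ] F}
    (h : ∀ s : S.Surf b, T (P.ket (P.single s)) = T' (P.ket (P.single s))) : T = T' := by
  ext x
  exact P.mem_of_ket_single_mem (LinearMap.eqLocus T.toLinearMap T'.toLinearMap)
    (isClosed_eq T.continuous T'.continuous) h x

/-- The trace inequality passes to the completion one argument at a time; this is the first. -/
theorem norm_PsiR_ket_le (x : P.Comb (Sum.elim b d)) (y : P.Hilb (Sum.elim d c)) :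
    ‖P.PsiR y (P.ket x)‖ ≤ ‖x‖ * ‖y‖ := by
  refine P.denseRange_ket.induction_on (p := fun y => ‖P.PsiR y (P.ket x)‖ ≤ ‖x‖ * ‖y‖) y ?_ ?_
  · exact isClosed_le (P.PsiR.flip (P.ket x)).continuous.norm
      (continuous_const.mul continuous_norm)
  · intro y
    rw [P.PsiR_ket_ket, norm_ket, norm_ket]
    exact P.norm_glueₗ_le x y

theorem norm_PsiR_le (x : P.Hilb (Sum.elim b d)) (y : P.Hilb (Sum.elim d c)) :
    ‖P.PsiR y x‖ ≤ ‖x‖ * ‖y‖ := by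
  refine P.denseRange_ket.induction_on (p := fun x => ‖P.PsiR y x‖ ≤ ‖x‖ * ‖y‖) x ?_ ?_
  · exact isClosed_le (P.PsiR y).continuous.norm (continuous_norm.mul continuous_const)
  · intro x
    rw [norm_ket]
    exact P.norm_PsiR_ket_le x y

theorem PsiR_single (s : S.Surf (Sum.elim b d)) (t : S.Surf (Sum.elim d c)) :
    P.PsiR (P.ket (P.single t)) (P.ket (P.single s)) = P.ket (P.single (glue s t)) := by
  rw [P.PsiR_ket_ket, P.glueₗ_single]

/-- Associativity of gluing, extended by density and continuity first in `z`, then in `y`, then in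
`x`. -/
theorem PsiR_PsiR (x : P.Hilb (Sum.elim b d)) (y : P.Hilb (Sum.elim d f))
    (z : P.Hilb (Sum.elim f c)) : P.PsiR z (P.PsiR y x) = P.PsiR (P.PsiR z y) x := by
  have h₁ : ∀ s t, P.PsiR z (P.PsiR (P.ket (P.single (b := Sum.elim d f) t))
      (P.ket (P.single (b := Sum.elim b d) s))) =
      P.PsiR (P.PsiR z (P.ket (P.single t))) (P.ket (P.single s)) := fun s t =>
    DFunLike.congr_fun (P.clm_ext
      (T := P.PsiR.flip (P.PsiR (P.ket (P.single t)) (P.ket (P.single s))))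
      (T' := P.PsiR.flip (P.ket (P.single s)) ∘L P.PsiR.flip (P.ket (P.single t)))
      fun r => by
        simp only [ContinuousLinearMap.flip_apply, ContinuousLinearMap.comp_apply, PsiR_single,
          glue_assoc]) z
  have h₂ : ∀ s, P.PsiR z (P.PsiR y (P.ket (P.single (b := Sum.elim b d) s))) =
      P.PsiR (P.PsiR z y) (P.ket (P.single s)) := fun s =>
    DFunLike.congr_fun (P.clm_ext
      (T := P.PsiR z ∘L P.PsiR.flip (P.ket (P.single s)))
      (T' := P.PsiR.flip (P.ket (P.single s)) ∘L P.PsiR z) (h₁ s)) y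
  exact DFunLike.congr_fun (P.clm_ext (T := P.PsiR z ∘L P.PsiR y) (T' := P.PsiR (P.PsiR z y)) h₂) x

theorem inner_PsiR_single (s : S.Surf (Sum.elim b d)) (x : P.Hilb (Sum.elim d c))
    (y : P.Hilb (Sum.elim b c)) : inner ℂ (P.PsiR x (P.ket (P.single s))) y =
      inner ℂ x (P.PsiR y (P.ket (P.single (dagger s)))) := by
  have h : ∀ t, inner ℂ (P.PsiR (P.ket (P.single t)) (P.ket (P.single s))) y =
      inner ℂ (P.ket (P.single (b := Sum.elim d c) t)) (P.PsiR y (P.ket (P.single (dagger s)))) :=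
    fun t => DFunLike.congr_fun (P.clm_ext
      (T := innerSL ℂ (P.PsiR (P.ket (P.single t)) (P.ket (P.single s))))
      (T' := innerSL ℂ (P.ket (P.single t)) ∘L P.PsiR.flip (P.ket (P.single (dagger s))))
      fun r => by
        simp only [ContinuousLinearMap.flip_apply, ContinuousLinearMap.comp_apply, PsiR_single,
          innerSL_apply_apply, inner_ket, inner_single, bracket_glue_left]) y
  -- The inner product is antilinear in `x`; conjugating makes both sides linear, so that `clm_ext`
  -- applies.
  rw [← inner_conj_symm, ← inner_conj_symm x]
  congr 1
  refine DFunLike.congr_fun (P.clm_ext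
    (T := innerSL ℂ y ∘L P.PsiR.flip (P.ket (P.single s)))
    (T' := innerSL ℂ (P.PsiR y (P.ket (P.single (dagger s))))) fun t => ?_) x
  simp only [ContinuousLinearMap.flip_apply, ContinuousLinearMap.comp_apply, innerSL_apply_apply]
  rw [← inner_conj_symm, h, inner_conj_symm]

/-- An operator commuting with left gluing of surfaces commutes with the left von Neumann
algebra. -/
theorem commute_of_mem_vonNeumannL {B B' : S.Bdry}
    {a : P.Hilb (S.two B B') →L[ℂ] P.Hilb (S.two B B')} (ha : a ∈ P.vonNeumannL B B')
    (X : P.Hilb (S.two B B') →L[ℂ] P.Hilb (S.two B B'))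
    (hX : ∀ (s : S.Surf (S.two B B)) (x : P.Hilb (S.two B B')),
      X (P.PsiR x (P.ket (P.single s))) = P.PsiR (X x) (P.ket (P.single s)))
    (x : P.Hilb (S.two B B')) : X (a x) = a (X x) := by
  have hX' : ∀ (g : P.Comb (S.two B B)) (x : P.Hilb (S.two B B')),
      X (P.leftOp B' g x) = P.leftOp B' g (X x) := fun g x =>
    DFunLike.congr_fun (P.clm_ext (T := X ∘L P.PsiR x) (T' := P.PsiR (X x)) fun s => hX s x)
      (P.ket g)
  refine ext_inner_left ℂ fun y => ?_
  -- With `X` moved to `y`, both sides are matrix coefficients of `a`, so for fixed `x`, `y` the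
  -- identity defines a closed set in the weak operator topology.
  rw [← ContinuousLinearMap.adjoint_inner_left]
  refine closure_minimal (s := Set.range fun a : P.Comb (S.two B B) =>
      ContinuousLinearMapWOT.ofCLM (P.leftOp B' a))
    (t := {T | inner ℂ (ContinuousLinearMap.adjoint X y) (T x) = inner ℂ y (T (X x))}) ?_ ?_ ha
  · rintro _ ⟨g, rfl⟩
    change inner ℂ _ (P.leftOp B' g x) = inner ℂ y (P.leftOp B' g (X x))
    rw [ContinuousLinearMap.adjoint_inner_left, hX']
  · exact isClosed_eq (ContinuousLinearMapWOT.continuous_iff.1 continuous_id _ _)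
      (ContinuousLinearMapWOT.continuous_iff.1 continuous_id _ _)

end

end PathIntegral

/-! ### The cylinder semigroup at small length. -/

namespace PathIntegral

open SurfaceCalculus

noncomputable section

variable {S : SourceManifolds.{u, v}} (P : PathIntegral S)
variable {κ : Type} {B : S.Bdry} {c : κ → S.Bdry}

theorem dagger_cyl {β : ℝ} (hβ : 0 < β) : dagger (S.cyl B β) = S.cyl B β := by
  unfold dagger
  rw [S.cyl_star B β hβ, S.cyl_swap B β hβ]

theorem PsiR_cylKet_add {α β : ℝ} (hα : 0 < α) (hβ : 0 < β)
    (x : P.Hilb (Sum.elim (fun _ : Unit => B) c)) :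
    P.PsiR x (P.cylKet B (α + β)) = P.PsiR (P.PsiR x (P.cylKet B β)) (P.cylKet B α) := by
  rw [← PsiR_PsiR, cylKet, cylKet, cylKet, PsiR_single, S.cyl_glue B α β hα hβ]

theorem inner_PsiR_cylKet {β : ℝ} (hβ : 0 < β)
    (x y : P.Hilb (Sum.elim (fun _ : Unit => B) c)) :
    inner ℂ (P.PsiR x (P.cylKet B β)) y = inner ℂ x (P.PsiR y (P.cylKet B β)) := by
  rw [cylKet, inner_PsiR_single, dagger_cyl hβ]

/-- Cylinders act as a symmetric semigroup, so only the total length matters. -/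
theorem inner_PsiR_cylKet_PsiR_cylKet {α β : ℝ} (hα : 0 < α) (hβ : 0 < β)
    (x y : P.Hilb (Sum.elim (fun _ : Unit => B) c)) :
    inner ℂ (P.PsiR x (P.cylKet B α)) (P.PsiR y (P.cylKet B β)) =
      inner ℂ x (P.PsiR y (P.cylKet B (α + β))) := by
  rw [inner_PsiR_cylKet P hα, ← PsiR_cylKet_add P hα hβ]

/-- By the trace form, this coefficient is `ζ` of a closed manifold containing the cylinder, with
complement `t s†`. -/
theorem continuousOn_inner_PsiR_cylKet (s t : S.Surf (Sum.elim (fun _ : Unit => B) c)) :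
    ContinuousOn (fun β => inner ℂ (P.ket (P.single s))
      (P.PsiR (P.ket (P.single t)) (P.cylKet B β))) (Set.Ioi 0) := by
  refine (P.continuity B (glue t (dagger s))).congr fun β _ => ?_
  rw [cylKet, PsiR_single, inner_ket, inner_single, bracket_eq_closeUp, glue_assoc]

/-- The semigroup of cylinders is bounded near zero length. -/
theorem exists_norm_PsiR_cylKet_le (B : S.Bdry) : ∃ M : ℝ, ∀ {κ : Type} {c : κ → S.Bdry}
    (β : ℝ), 0 < β → β ≤ 1 → ∀ x : P.Hilb (Sum.elim (fun _ : Unit => B) c),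
      ‖P.PsiR x (P.cylKet B β)‖ ≤ M * ‖x‖ := by
  -- For `1 ≤ t ≤ 2`, splitting off a cylinder of length `1/2` makes `‖C_t‖²` a coefficient at
  -- length `2t - 1`, which lies in `[1, 3]`.
  obtain ⟨K, hK⟩ := (isCompact_Icc (a := (1 : ℝ)) (b := 3)).exists_bound_of_continuousOn
    ((P.continuousOn_inner_PsiR_cylKet (S.cyl B (1 / 2)) (S.cyl B (1 / 2))).mono
      fun u hu => lt_of_lt_of_le one_pos hu.1)
  have hcyl : ∀ t : ℝ, 1 ≤ t → t ≤ 2 → ‖P.cylKet B t‖ ^ 2 ≤ K := fun t h1 h2 => by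
    have e : P.cylKet B t = P.PsiR (P.cylKet B (1 / 2)) (P.cylKet B (t - 1 / 2)) := by
      have := S.cyl_glue B (t - 1 / 2) (1 / 2) (by linarith) (by norm_num)
      rw [cylKet, cylKet, cylKet, PsiR_single, this, sub_add_cancel]
    have h := hK (t - 1 / 2 + (t - 1 / 2)) ⟨by linarith, by linarith⟩
    change ‖inner ℂ (P.cylKet B (1 / 2)) (P.PsiR (P.cylKet B (1 / 2)) _)‖ ≤ K at h
    rw [← inner_PsiR_cylKet_PsiR_cylKet P (by linarith) (by linarith), ← e,
      inner_self_eq_norm_sq_to_K] at h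
    simpa using h
  have hK0 : 0 ≤ K := (sq_nonneg _).trans (hcyl 1 le_rfl one_le_two)
  -- `K + 1` dominates `√K` and is at least `1`, so it survives the square roots taken when lengths
  -- are halved.
  refine ⟨K + 1, fun {κ c} => ?_⟩
  -- Induction on the number of doublings that bring `β` into `[1, 2]`, where the trace inequality
  -- gives the bound.
  have key : ∀ (n : ℕ) (β : ℝ), 1 ≤ 2 ^ n * β → 2 ^ n * β ≤ 2 →
      ∀ x : P.Hilb (Sum.elim (fun _ : Unit => B) c),
      ‖P.PsiR x (P.cylKet B β)‖ ≤ (K + 1) * ‖x‖ := by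
    intro n
    induction n with
    | zero =>
      intro β h1 h2 x
      simp only [pow_zero, one_mul] at h1 h2
      refine (P.norm_PsiR_le _ _).trans (mul_le_mul_of_nonneg_right ?_ (norm_nonneg _))
      nlinarith [hcyl β h1 h2]
    | succ n ih =>
      intro β h1 h2 x
      rw [pow_succ, mul_assoc, two_mul β] at h1 h2
      have hβ : 0 < β := by
        by_contra! h
        have : (2 : ℝ) ^ n * (β + β) ≤ 0 :=
          mul_nonpos_of_nonneg_of_nonpos (by positivity) (by linarith)
        linarith
      -- `‖C_β x‖² = ⟨x|C_{2β} x⟩ ≤ ‖x‖ ‖C_{2β} x‖`.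
      have e : ‖P.PsiR x (P.cylKet B β)‖ ^ 2 ≤ ((K + 1) * ‖x‖) ^ 2 := by
        have h := norm_inner_le_norm (𝕜 := ℂ) x (P.PsiR x (P.cylKet B (β + β)))
        rw [← inner_PsiR_cylKet_PsiR_cylKet P hβ hβ, inner_self_eq_norm_sq_to_K] at h
        have h3 : ‖P.PsiR x (P.cylKet B β)‖ ^ 2 ≤ ‖x‖ * ((K + 1) * ‖x‖) :=
          (by simpa using h : _ ≤ _).trans
            (mul_le_mul_of_nonneg_left (ih (β + β) h1 h2 x) (norm_nonneg _))
        nlinarith [mul_nonneg hK0 (sq_nonneg ‖x‖), mul_nonneg (sq_nonneg K) (sq_nonneg ‖x‖)]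
      exact (sq_le_sq₀ (norm_nonneg _) (by positivity)).1 e
  intro β h0 h1
  obtain ⟨n, hn, hn'⟩ := exists_nat_pow_near (x := 2 / β) (y := 2)
    ((one_le_div h0).2 (by linarith)) one_lt_two
  refine key n β ?_ ((le_div_iff₀ h0).1 hn)
  rw [div_lt_iff₀ h0, pow_succ] at hn'
  linarith

/-- A uniformly bounded family of operators that converges on all surfaces converges strongly. -/
theorem exists_tendsto_of_tendsto_single {κ : Type} {b : κ → S.Bdry} {F : Type*}
    [NormedAddCommGroup F] [NormedSpace ℂ F] [CompleteSpace F] {T : ℝ → P.Hilb b →L[ℂ] F} {M : ℝ}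
    (hM : ∀ᶠ β in 𝓝[>] (0 : ℝ), ∀ x, ‖T β x‖ ≤ M * ‖x‖)
    (h : ∀ s : S.Surf b, ∃ y, Tendsto (fun β => T β (P.ket (P.single s))) (𝓝[>] 0) (𝓝 y)) :
    ∃ T₀ : P.Hilb b →L[ℂ] F, ∀ x, Tendsto (fun β => T β x) (𝓝[>] 0) (𝓝 (T₀ x)) := by
  let V : Submodule ℂ (P.Hilb b) :=
    { carrier := {x | ∃ y, Tendsto (fun β => T β x) (𝓝[>] 0) (𝓝 y)}
      zero_mem' := ⟨0, by simp⟩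
      add_mem' := by
        rintro x x' ⟨y, hy⟩ ⟨y', hy'⟩
        exact ⟨y + y', by simpa using hy.add hy'⟩
      smul_mem' := by
        rintro z x ⟨y, hy⟩
        exact ⟨z • y, by simpa using hy.const_smul z⟩ }
  have hV : IsClosed (V : Set (P.Hilb b)) := by
    refine isClosed_of_closure_subset fun x hx => ?_
    refine cauchy_map_iff_exists_tendsto.1 (Metric.cauchy_iff.2 ⟨inferInstance, fun ε hε => ?_⟩)
    -- `|M| + 1` is positive whatever the sign of `M`.
    have hδ : 0 < ε / (4 * (|M| + 1)) := by positivity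
    obtain ⟨x', ⟨y, hy⟩, hxx⟩ := Metric.mem_closure_iff.1 hx _ hδ
    refine ⟨_, image_mem_map (hM.and (Metric.tendsto_nhds.1 hy (ε / 4) (by positivity))), ?_⟩
    have key : ∀ β, (∀ x, ‖T β x‖ ≤ M * ‖x‖) ∧ dist (T β x') y < ε / 4 →
        dist (T β x) y < ε / 2 := by
      rintro β ⟨h1, h2⟩
      have h3 : dist (T β x) (T β x') < ε / 4 := by
        rw [dist_eq_norm, ← map_sub]
        rw [dist_eq_norm] at hxx
        refine (h1 _).trans_lt ?_
        calc M * ‖x - x'‖ ≤ (|M| + 1) * ‖x - x'‖ :=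
              mul_le_mul_of_nonneg_right (by linarith [le_abs_self M]) (norm_nonneg _)
          _ < (|M| + 1) * (ε / (4 * (|M| + 1))) := by gcongr
          _ = ε / 4 := by field_simp
      linarith [dist_triangle (T β x) (T β x') y]
    rintro _ ⟨β, hβ, rfl⟩ _ ⟨β', hβ', rfl⟩
    linarith [dist_triangle_right (T β x) (T β' x) y, key β hβ, key β' hβ']
  choose L hL using P.mem_of_ket_single_mem V hV h
  exact ⟨continuousLinearMapOfTendsto T (tendsto_pi_nhds.2 hL), hL⟩

/-- The semigroup of cylinders is strongly continuous at zero length. -/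
theorem tendsto_PsiR_cylKet (x : P.Hilb (Sum.elim (fun _ : Unit => B) c)) :
    Tendsto (fun β => P.PsiR x (P.cylKet B β)) (𝓝[>] 0) (𝓝 x) := by
  have hs : ∀ s : S.Surf (Sum.elim (fun _ : Unit => B) c),
      Tendsto (fun β => P.PsiR (P.ket (P.single s)) (P.cylKet B β)) (𝓝[>] 0)
        (𝓝 (P.ket (P.single s))) := by
    intro s
    -- The rim keeps the cylinder lengths below near `2ε > 0`, where the continuity axiom applies.
    obtain ⟨ε, hε, t, rfl⟩ := S.rim B c s
    set k := P.ket (P.single t) with hk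
    have hs : P.ket (P.single (glue (S.cyl B ε) t)) = P.PsiR k (P.cylKet B ε) := by
      rw [cylKet, PsiR_single]
    have hg : ContinuousOn (fun β => inner ℂ k (P.PsiR k (P.cylKet B β))) (Set.Ioi 0) :=
      P.continuousOn_inner_PsiR_cylKet t t
    have hlim : ∀ q : ℝ → ℝ, Continuous q → q 0 = ε + ε →
        Tendsto (fun β => inner ℂ k (P.PsiR k (P.cylKet B (q β)))) (𝓝[>] 0)
          (𝓝 (inner ℂ k (P.PsiR k (P.cylKet B (ε + ε))))) := fun q hq h0 =>
      (hg.continuousAt (Ioi_mem_nhds (add_pos hε hε))).tendsto.comp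
        (h0 ▸ hq.continuousAt.tendsto.mono_left nhdsWithin_le_nhds)
    -- With `g(u) = ⟨k|C_u k⟩`, the square expands to `g(2β + 2ε) - 2g(β + 2ε) + g(2ε)`, which tends
    -- to zero.
    have h2 : Tendsto (fun β => ‖P.PsiR (P.PsiR k (P.cylKet B ε)) (P.cylKet B β) -
        P.PsiR k (P.cylKet B ε)‖ ^ 2) (𝓝[>] 0) (𝓝 0) := by
      have := Complex.continuous_re.continuousAt.tendsto.comp
        ((((hlim (fun β => (β + ε) + (β + ε)) (by fun_prop) (by ring)).sub
        (hlim (fun β => (β + ε) + ε) (by fun_prop) (by ring))).sub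
        (hlim (fun β => ε + (β + ε)) (by fun_prop) (by ring))).add_const
        (inner ℂ k (P.PsiR k (P.cylKet B (ε + ε)))))
      simp only [sub_self, zero_sub, neg_add_cancel, Complex.zero_re] at this
      refine this.congr' ?_
      filter_upwards [self_mem_nhdsWithin] with β hβ
      have hβε : 0 < β + ε := add_pos hβ hε
      rw [← PsiR_cylKet_add P hβ hε, @norm_sq_eq_re_inner ℂ, inner_sub_left, inner_sub_right,
        inner_sub_right]
      simp only [Function.comp_apply]
      rw [inner_PsiR_cylKet_PsiR_cylKet P hβε hβε, inner_PsiR_cylKet_PsiR_cylKet P hβε hε,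
        inner_PsiR_cylKet_PsiR_cylKet P hε hβε, inner_PsiR_cylKet_PsiR_cylKet P hε hε]
      simp only [RCLike.re_to_complex, Complex.add_re, Complex.sub_re]
      ring
    rw [hs, tendsto_iff_norm_sub_tendsto_zero]
    simpa using h2.sqrt
  obtain ⟨M, hM⟩ := P.exists_norm_PsiR_cylKet_le B
  obtain ⟨T₀, hT₀⟩ := P.exists_tendsto_of_tendsto_single
    (T := fun β => P.PsiR.flip (P.cylKet B β)) (M := M)
    (by filter_upwards [Ioc_mem_nhdsGT one_pos] with β hβ using hM β hβ.1 hβ.2)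
    fun s => ⟨_, hs s⟩
  have : T₀ = ContinuousLinearMap.id ℂ _ :=
    P.clm_ext fun s => tendsto_nhds_unique (hT₀ _) (hs s)
  simpa [this] using hT₀ x

end

end PathIntegral

/-! ### The modulus of right gluing and the operator `Φ`. -/

namespace PathIntegral

open SurfaceCalculus

noncomputable section

variable {S : SourceManifolds.{u, v}} (P : PathIntegral S) {BL BR : S.Bdry}

/-- The modulus is self-adjoint with square `γ̂_R† γ̂_R`. It thus replaces `γ̂_R` by an operator on
`ℋ_{LL}`, where `a` acts. -/
theorem inner_absPsiR (γ : P.Hilb (S.two BL BR)) (x y : P.Hilb (S.two BL BL)) :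
    inner ℂ (P.absPsiR BL BR γ x) (P.absPsiR BL BR γ y) = inner ℂ (P.PsiR γ x) (P.PsiR γ y) := by
  have h0 : 0 ≤ ContinuousLinearMap.adjoint (P.PsiR (b := fun _ : Unit => BL) γ) ∘L
      P.PsiR (b := fun _ : Unit => BL) γ :=
    (ContinuousLinearMap.nonneg_iff_isPositive _).2
      (ContinuousLinearMap.isPositive_adjoint_comp_self _)
  have h1 : IsSelfAdjoint (P.absPsiR BL BR γ) := IsSelfAdjoint.of_nonneg (CFC.sqrt_nonneg _)
  rw [← ContinuousLinearMap.adjoint_inner_right, h1.adjoint_eq,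
    ← ContinuousLinearMap.adjoint_inner_right]
  exact congrArg _ (DFunLike.congr_fun (CFC.sqrt_mul_sqrt_self _ h0) y)

theorem norm_absPsiR (γ : P.Hilb (S.two BL BR)) (x : P.Hilb (S.two BL BL)) :
    ‖P.absPsiR BL BR γ x‖ = ‖P.PsiR γ x‖ := by
  rw [@norm_eq_sqrt_re_inner ℂ, inner_absPsiR, ← @norm_eq_sqrt_re_inner ℂ]

/-- The left von Neumann algebra commutes with `|γ̂_R|`. -/
theorem absPsiR_comm {a : P.Hilb (S.two BL BL) →L[ℂ] P.Hilb (S.two BL BL)}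
    (ha : a ∈ P.vonNeumannL BL BL) (γ : P.Hilb (S.two BL BR)) (x : P.Hilb (S.two BL BL)) :
    P.absPsiR BL BR γ (a x) = a (P.absPsiR BL BR γ x) := by
  have h : Commute (ContinuousLinearMap.adjoint (P.PsiR (b := fun _ : Unit => BL) γ) ∘L
      P.PsiR (b := fun _ : Unit => BL) γ) a := by
    refine ContinuousLinearMap.ext fun x => P.commute_of_mem_vonNeumannL ha
      (ContinuousLinearMap.adjoint (P.PsiR (b := fun _ : Unit => BL) γ) ∘L
        P.PsiR (b := fun _ : Unit => BL) γ) (fun s x => ?_) x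
    refine ext_inner_left ℂ fun y => ?_
    simp only [ContinuousLinearMap.comp_apply]
    -- Left gluing of `s` passes through `γ̂_R` by associativity, and through its adjoint because
    -- `dagger s` also passes through `γ̂_R`.
    rw [ContinuousLinearMap.adjoint_inner_right, PsiR_PsiR, ← inner_conj_symm, inner_PsiR_single,
      inner_conj_symm, ← PsiR_PsiR, ← ContinuousLinearMap.adjoint_inner_right, ← inner_conj_symm,
      ← inner_conj_symm y, inner_PsiR_single]
  -- Commutation passes to the square root through the functional calculus.
  exact DFunLike.congr_fun (h.cfcₙ_nnreal NNReal.sqrt) x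

theorem PsiR_comm {a : P.Hilb (S.two BL BL) →L[ℂ] P.Hilb (S.two BL BL)}
    (ha : a ∈ P.vonNeumannL BL BL) (x y : P.Hilb (S.two BL BL)) :
    P.PsiR y (a x) = a (P.PsiR y x) :=
  P.commute_of_mem_vonNeumannL ha (P.PsiR y) (fun _ _ => P.PsiR_PsiR _ _ _) x

/-- After passing to `|γ̂_R|`, `a` can be moved to the outside and estimated by its norm. This
bounds the approximants of `Φ(a)`. -/
theorem norm_PsiR_apply_le {a : P.Hilb (S.two BL BL) →L[ℂ] P.Hilb (S.two BL BL)}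
    (ha : a ∈ P.vonNeumannL BL BL) (γ : P.Hilb (S.two BL BR)) (x : P.Hilb (S.two BL BL)) :
    ‖P.PsiR γ (a x)‖ ≤ ‖a‖ * ‖P.PsiR γ x‖ := by
  rw [← norm_absPsiR, absPsiR_comm P ha, ← norm_absPsiR]
  exact a.le_opNorm _

/-- Every surface is rimmed, so the defining equation reaches all of them. -/
theorem IsPhi.ext {a : P.Hilb (S.two BL BL) →L[ℂ] P.Hilb (S.two BL BL)}
    {T T' : P.Hilb (S.two BL BR) →L[ℂ] P.Hilb (S.two BL BR)}
    (h : P.IsPhi BL BR a T) (h' : P.IsPhi BL BR a T') : T = T' := by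
  refine P.clm_ext fun s => ?_
  obtain ⟨ε, hε, t, rfl⟩ := S.rim BL _ s
  rw [← glueₗ_single, h ε hε, h' ε hε]

/-- Density extends the defining equation to vectors `γ` that no formal combination represents. -/
theorem IsPhi.apply_PsiR {a : P.Hilb (S.two BL BL) →L[ℂ] P.Hilb (S.two BL BL)}
    {T : P.Hilb (S.two BL BR) →L[ℂ] P.Hilb (S.two BL BR)} (h : P.IsPhi BL BR a T)
    {ε : ℝ} (hε : 0 < ε) (γ : P.Hilb (S.two BL BR)) :
    T (P.PsiR γ (P.cylKet BL ε)) = P.PsiR γ (a (P.cylKet BL ε)) :=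
  DFunLike.congr_fun (P.clm_ext (T := T ∘L P.PsiR.flip (P.cylKet BL ε))
    (T' := P.PsiR.flip (a (P.cylKet BL ε))) fun s => by
      simpa only [ContinuousLinearMap.comp_apply, ContinuousLinearMap.flip_apply, cylKet,
        PsiR_ket_ket] using h ε hε (P.single s)) γ

theorem exists_isPhi {a : P.Hilb (S.two BL BL) →L[ℂ] P.Hilb (S.two BL BL)}
    (ha : a ∈ P.vonNeumannL BL BL) (BR : S.Bdry) : ∃ T, P.IsPhi BL BR a T := by
  obtain ⟨M, hM⟩ := P.exists_norm_PsiR_cylKet_le BL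
  have hlim : ∀ (ε : ℝ), 0 < ε → ∀ φ : P.Hilb (S.two BL BR),
      Tendsto (fun β => P.PsiR (P.PsiR φ (P.cylKet BL ε)) (a (P.cylKet BL β))) (𝓝[>] 0)
        (𝓝 (P.PsiR φ (a (P.cylKet BL ε)))) := by
    intro ε hε φ
    -- Right gluing of `C_ε` commutes with `a`, so the approximant equals `φ̂_R a|C_β C_ε⟩`, and
    -- `C_β C_ε` tends to `C_ε`.
    have h := ((P.PsiR φ ∘L a).continuous.tendsto _).comp (P.tendsto_PsiR_cylKet (P.cylKet BL ε))
    refine h.congr fun β => ?_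
    simp only [Function.comp_apply, ContinuousLinearMap.comp_apply]
    rw [← PsiR_PsiR, PsiR_comm P ha]
  obtain ⟨T, hT⟩ := P.exists_tendsto_of_tendsto_single (b := S.two BL BR)
    (T := fun β => P.PsiR.flip (a (P.cylKet BL β))) (M := ‖a‖ * M)
    (by
      filter_upwards [Ioc_mem_nhdsGT one_pos] with β hβ x
      refine (P.norm_PsiR_apply_le ha x _).trans ?_
      rw [mul_assoc]
      exact mul_le_mul_of_nonneg_left (hM β hβ.1 hβ.2 x) (norm_nonneg _))
    fun s => by
      obtain ⟨ε, hε, t, rfl⟩ := S.rim BL _ s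
      have h := hlim ε hε (P.ket (P.single t))
      simp only [cylKet, PsiR_single] at h
      exact ⟨_, h⟩
  refine ⟨T, fun ε hε φ => tendsto_nhds_unique (hT _) ?_⟩
  simpa only [cylKet, PsiR_ket_ket, ContinuousLinearMap.flip_apply] using hlim ε hε (P.ket φ)

theorem Phi_spec {a : P.Hilb (S.two BL BL) →L[ℂ] P.Hilb (S.two BL BL)}
    (ha : a ∈ P.vonNeumannL BL BL) (BR : S.Bdry) : P.IsPhi BL BR a (P.Phi BL BR a) := by
  have h := P.exists_isPhi ha BR
  rw [Phi, dif_pos h]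
  exact h.choose_spec

/-- The differences have the same norms as those of the convergent family `γ̂_R|C_β⟩`, so the Cauchy
property carries over without any convergence of `|C_β⟩`. -/
theorem exists_tendsto_absPsiR_cylKet (γ : P.Hilb (S.two BL BR)) :
    ∃ γLL : P.Hilb (S.two BL BL),
      Tendsto (fun β : ℝ => P.absPsiR BL BR γ (P.cylKet BL β)) (𝓝[>] 0) (𝓝 γLL) := by
  have h := Metric.cauchy_iff.1 (P.tendsto_PsiR_cylKet γ).cauchy_map
  refine cauchy_map_iff_exists_tendsto.1 (Metric.cauchy_iff.2 ⟨inferInstance, fun ε hε => ?_⟩)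
  obtain ⟨t, ht, hd⟩ := h.2 ε hε
  refine ⟨_, image_mem_map ht, ?_⟩
  rintro _ ⟨β, hβ, rfl⟩ _ ⟨β', hβ', rfl⟩
  rw [dist_eq_norm, ← map_sub, norm_absPsiR, map_sub, ← dist_eq_norm]
  exact hd _ hβ _ hβ'

end

end PathIntegral

theorem mainTheorem8 (S : SourceManifolds.{u, v}) (P : PathIntegral S) (BL BR : S.Bdry) :
    (∀ a ∈ P.vonNeumannL BL BL, ∃! T, P.IsPhi BL BR a T) ∧
    ∀ γ : P.Hilb (S.two BL BR), ∃ γLL : P.Hilb (S.two BL BL),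
      Tendsto (fun β : ℝ => P.absPsiR BL BR γ (P.cylKet BL β)) (𝓝[>] 0) (𝓝 γLL) ∧
      ∀ a ∈ P.vonNeumannL BL BL, inner ℂ γ (P.Phi BL BR a γ) = inner ℂ γLL (a γLL) := by
  refine ⟨fun a ha => ?_, fun γ => ?_⟩
  · obtain ⟨T, hT⟩ := P.exists_isPhi ha BR
    exact ⟨T, hT, fun T' hT' => PathIntegral.IsPhi.ext P hT' hT⟩
  · obtain ⟨γLL, h⟩ := P.exists_tendsto_absPsiR_cylKet γ
    refine ⟨γLL, h, fun a ha => ?_⟩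
    have hγ := P.tendsto_PsiR_cylKet γ
    -- Both sides are limits of expectation values regularized by `C_β`, which agree for every `β >
    -- 0`.
    refine tendsto_nhds_unique
      (hγ.inner (((P.Phi BL BR a).continuous.tendsto γ).comp hγ))
      ((h.inner ((a.continuous.tendsto γLL).comp h)).congr' ?_)
    filter_upwards [self_mem_nhdsWithin] with β hβ
    simp only [Function.comp_apply]
    rw [PathIntegral.IsPhi.apply_PsiR P (P.Phi_spec ha BR) hβ, ← P.absPsiR_comm ha,
      P.inner_absPsiR]
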